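/- Consider the following game of cops and robber on a finite simple graph $G$. First $k$ cops choose initial vertices of $G$ (several cops may share a vertex), and then the robber, seeing them, chooses an initial vertex. In each round every cop stays at its vertex or moves to a neighboring vertex, and then the robber stays or moves to a neighboring vertex; both sides see all positions. The robber is captured as soon as some cop occupies the same vertex as the robber. Let $\operatorname{capt}_k(G)$ be the least number $t$ of rounds such that $k$ cops can guarantee capture within $t$ rounds (the initial placement counts as $0$ rounds, and $\operatorname{capt}_k(G)=\infty$ if there is no such $t$), and let the throttling number of $G$ be $\operatorname{th}_c(G)=\min_{k\ge 1}\,(k+\operatorname{capt}_k(G))$. A cactus graph is a connected graph in which any two distinct simple cycles have at most one vertex in common. Theorem. For cactus graphs $G$ of order $n$, $\operatorname{th}_c(G)=O(\sqrt{n})$; that is, there is an absolute constant $C$ such that $\operatorname{th}_c(G)\le C\sqrt{n}$ for every finite cactus graph $G$ of order $n$. Specifically, $\operatorname{th}_c(G)\le 16\sqrt{n}+16$ for every such $G$. -/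

import Mathlib

universe u

/-- A cactus graph: a connected graph in which any two different simple cycles (compared as
subgraphs) have at most one vertex in common. -/
def IsCactus {V : Type u} (G : SimpleGraph V) : Prop :=
  G.Connected ∧
    ∀ (a b : V) (p : G.Walk a a) (q : G.Walk b b), p.IsCycle → q.IsCycle →
      p.toSubgraph ≠ q.toSubgraph →
        ∀ x y : V, x ∈ p.support → x ∈ q.support → y ∈ p.support → y ∈ q.support → x = y

/-- A move in the game along one turn: stay at the vertex or go to a neighbour. -/
def LegalMove {V : Type u} (G : SimpleGraph V) (a b : V) : Prop :=
  a = b ∨ G.Adj a b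

/-- The robber at `r` is captured by the cops at the vertices `c i` (several cops may share a
vertex). -/
def Captured {V : Type u} {k : ℕ} (c : Fin k → V) (r : V) : Prop :=
  ∃ i, c i = r

/-- `CopsCanCapture G t c r`: from the position with the cops at `c`, the robber at `r`, and the
cops to move, the cops can force a capture within `t` further rounds, whatever the robber does.
In a round all cops move (to `c'`); if this does not capture the robber, the robber, who sees the
move, moves (to `r'`). Zero rounds are needed if the robber is already captured. -/
def CopsCanCapture {V : Type u} (G : SimpleGraph V) {k : ℕ} :
    ℕ → (Fin k → V) → V → Prop
  | 0, c, r => Captured c r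
  | t + 1, c, r =>
      Captured c r ∨
        ∃ c' : Fin k → V, (∀ i, LegalMove G (c i) (c' i)) ∧
          (Captured c' r ∨ ∀ r' : V, LegalMove G r r' → CopsCanCapture G t c' r')

/-- The cops have an initial placement of `k` cops from which, wherever the robber then chooses to
start, they can force a capture within `t` rounds. -/
def CopsWinWithin {V : Type u} (G : SimpleGraph V) (k t : ℕ) : Prop :=
  ∃ c : Fin k → V, ∀ r : V, CopsCanCapture G t c r

/-- The `k`-capture time: the least number of rounds within which `k` cops can force a capture,
and `⊤` if they cannot do so within any number of rounds. -/
noncomputable def captureTime {V : Type u} (G : SimpleGraph V) (k : ℕ) : ℕ∞ :=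
  ⨅ (t : ℕ) (_ : CopsWinWithin G k t), (t : ℕ∞)

/-- The throttling number: the minimum of `k + captureTime G k` over all positive integers `k`. -/
noncomputable def throttlingNumber {V : Type u} (G : SimpleGraph V) : ℕ∞ :=
  ⨅ (k : ℕ) (_ : 1 ≤ k), ((k : ℕ∞) + captureTime G k)

/-! In a cactus at most two edges join two disjoint connected sets, as three would give two distinct
cycles sharing an edge (`IsCactus.edge_between_unique`). Two consequences give the bound. Repeatedly
cutting off a minimal connected piece with at least `m` vertices costs two vertices per piece, so at
most `2n/m` vertices separate the graph into components smaller than `m`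
(`IsCactus.exists_separator`). With that separator guarded, two further cops shrink the robber's
component in time linear in its size (`IsCactus.copsCanCapture`). Taking `m` about `√n` balances
cops against rounds. -/

open SimpleGraph

/-! ### Connectedness inside a vertex set. -/

/-- `ReachIn G A x y`: there is a walk from `x` to `y` in `G` all of whose vertices lie in `A`. -/
def ReachIn {V : Type u} (G : SimpleGraph V) (A : Set V) (x y : V) : Prop :=
  ∃ w : G.Walk x y, ∀ z ∈ w.support, z ∈ A

/-- The set `A` is empty or induces a connected subgraph of `G`. -/
def ConnectedOn {V : Type u} (G : SimpleGraph V) (A : Set V) : Prop :=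
  ∀ x ∈ A, ∀ y ∈ A, ReachIn G A x y

namespace ReachIn

variable {V : Type u} {G : SimpleGraph V} {A B : Set V} {x y z : V}

theorem refl (hx : x ∈ A) : ReachIn G A x x :=
  ⟨.nil, by simpa using hx⟩

theorem symm (h : ReachIn G A x y) : ReachIn G A y x := by
  obtain ⟨w, hw⟩ := h
  exact ⟨w.reverse, by simpa using hw⟩

theorem trans (h : ReachIn G A x y) (h' : ReachIn G A y z) : ReachIn G A x z := by
  obtain ⟨w, hw⟩ := h
  obtain ⟨w', hw'⟩ := h'
  refine ⟨w.append w', fun z hz => ?_⟩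
  rw [Walk.mem_support_append_iff] at hz
  exact hz.elim (hw z) (hw' z)

theorem mono (hAB : A ⊆ B) (h : ReachIn G A x y) : ReachIn G B x y := by
  obtain ⟨w, hw⟩ := h
  exact ⟨w, fun z hz => hAB (hw z hz)⟩

theorem left_mem (h : ReachIn G A x y) : x ∈ A := by
  obtain ⟨w, hw⟩ := h
  exact hw _ w.start_mem_support

theorem right_mem (h : ReachIn G A x y) : y ∈ A :=
  h.symm.left_mem

theorem of_adj (hx : x ∈ A) (hy : y ∈ A) (h : G.Adj x y) : ReachIn G A x y := by
  refine ⟨.cons h .nil, fun z hz => ?_⟩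
  simp only [Walk.support_cons, Walk.support_nil, List.mem_cons, List.not_mem_nil, or_false] at hz
  rcases hz with rfl | rfl <;> assumption

theorem exists_isPath (h : ReachIn G A x y) :
    ∃ w : G.Walk x y, w.IsPath ∧ ∀ z ∈ w.support, z ∈ A := by
  classical
  obtain ⟨w, hw⟩ := h
  exact ⟨w.bypass, w.bypass_isPath, fun z hz => hw z (w.support_bypass_subset_support hz)⟩

/-- A walk inside `A` that leaves the set `K` uses an edge leaving `K`. -/
theorem exists_boundary {K : Set V} (h : ReachIn G A x y) (hx : x ∈ K) (hy : y ∉ K) :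
    ∃ a ∈ K, ∃ b ∉ K, a ∈ A ∧ b ∈ A ∧ G.Adj a b := by
  obtain ⟨w, hw⟩ := h
  obtain ⟨d, hd, h1, h2⟩ := w.exists_boundary_dart K hx hy
  exact ⟨d.fst, h1, d.snd, h2, hw _ (w.dart_fst_mem_support_of_mem_darts hd),
    hw _ (w.dart_snd_mem_support_of_mem_darts hd), d.adj⟩

end ReachIn

section Components

variable {V : Type u} {G : SimpleGraph V} {A : Set V} {x : V}

theorem connectedOn_component (G : SimpleGraph V) (A : Set V) (x : V) :
    ConnectedOn G {y | ReachIn G A x y} := by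
  have key : ∀ y, ReachIn G A x y → ReachIn G {y | ReachIn G A x y} x y := by
    rintro y ⟨w, hw⟩
    classical
    refine ⟨w, fun z hz => ⟨w.takeUntil z hz, fun z' hz' => hw z' ?_⟩⟩
    exact w.support_takeUntil_subset_support hz hz'
  intro y hy z hz
  exact (key y hy).symm.trans (key z hz)

theorem connectedOn_univ (h : G.Connected) : ConnectedOn G Set.univ := by
  intro x _ y _
  obtain ⟨w⟩ := h.preconnected x y
  exact ⟨w, fun _ _ => Set.mem_univ _⟩

theorem connectedOn_support {y : V} (w : G.Walk x y) : ConnectedOn G {z | z ∈ w.support} := by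
  classical
  have key : ∀ z ∈ w.support, ReachIn G {z | z ∈ w.support} x z := fun z hz =>
    ⟨w.takeUntil z hz, fun z' hz' => w.support_takeUntil_subset_support hz hz'⟩
  intro y hy z hz
  exact (key y hy).symm.trans (key z hz)

/-- Removing from a connected set `D` one component of `D \ {v}` leaves every remaining vertex
connected to `v`. -/
theorem reachIn_diff_component {D : Set V} {v z : V} (h : ReachIn G D z v)
    (hz : ¬ ReachIn G (D \ {v}) x z) :
    ReachIn G (D \ {y | ReachIn G (D \ {v}) x y}) z v := by
  obtain ⟨w, hw⟩ := h
  induction w with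
  | nil => exact .refl ⟨hw _ (by simp), hz⟩
  | @cons a b v hab p ih =>
    have haD : a ∈ D := hw a (by simp)
    have hbD : b ∈ D := hw b (by simp)
    by_cases hav : a = v
    · subst hav
      exact .refl ⟨haD, hz⟩
    · have hb : ¬ ReachIn G (D \ {v}) x b := fun hb =>
        hz (hb.trans (.of_adj hb.right_mem ⟨haD, hav⟩ hab.symm))
      exact (ReachIn.of_adj (A := D \ {y | ReachIn G (D \ {v}) x y}) ⟨haD, hz⟩ ⟨hbD, hb⟩ hab).trans
        (ih hb fun z hz => hw z (by simp [hz]))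

end Components

/-! ### Edges between disjoint connected sets in a cactus. -/

section Cactus

variable {V : Type u} {G : SimpleGraph V} {A B : Set V}

/-- Two different edges between disjoint connected sets lie on a cycle that has no further edge
between the two sets. -/
theorem exists_isCycle_of_two_edges (hA : ConnectedOn G A) (hB : ConnectedOn G B)
    (hAB : Disjoint A B) {a₁ a₂ b₁ b₂ : V} (ha₁ : a₁ ∈ A) (ha₂ : a₂ ∈ A) (hb₁ : b₁ ∈ B)
    (hb₂ : b₂ ∈ B) (h₁ : G.Adj a₁ b₁) (h₂ : G.Adj a₂ b₂) (hne : (a₂, b₂) ≠ (a₁, b₁)) :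
    ∃ c : G.Walk b₁ b₁, c.IsCycle ∧ a₁ ∈ c.support ∧ s(a₂, b₂) ∈ c.edges ∧
      ∀ a ∈ A, ∀ b ∈ B, s(a, b) ∈ c.edges → (a, b) = (a₁, b₁) ∨ (a, b) = (a₂, b₂) := by
  obtain ⟨p, hp, hpA⟩ := (hA a₁ ha₁ a₂ ha₂).exists_isPath
  obtain ⟨q, hq, hqB⟩ := (hB b₂ hb₂ b₁ hb₁).exists_isPath
  have hdis : ∀ x ∈ A, x ∉ B := fun x hx hx' => Set.disjoint_left.1 hAB hx hx'
  have hedge : ∀ a ∈ A, ∀ b ∈ B, s(a, b) ∈ (p.append (.cons h₂ q)).edges →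
      (a, b) = (a₂, b₂) := by
    intro a ha b hb h
    rw [Walk.edges_append, Walk.edges_cons, List.mem_append, List.mem_cons] at h
    rcases h with h | h | h
    · exact absurd hb (hdis b (hpA b (p.snd_mem_support_of_mem_edges h)))
    · rw [Sym2.eq_iff] at h
      rcases h with ⟨rfl, rfl⟩ | ⟨rfl, rfl⟩
      · rfl
      · exact absurd hb₂ (hdis _ ha)
    · exact absurd (hqB a (q.fst_mem_support_of_mem_edges h)) (hdis a ha)
  have hpath : (p.append (.cons h₂ q)).IsPath := by
    rw [Walk.isPath_def, Walk.support_append, Walk.support_cons, List.tail_cons,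
      List.nodup_append]
    refine ⟨hp.support_nodup, hq.support_nodup, ?_⟩
    rintro x hx y hy rfl
    exact hdis x (hpA x hx) (hqB x hy)
  refine ⟨.cons h₁.symm (p.append (.cons h₂ q)), ?_, by simp, by simp, ?_⟩
  · rw [Walk.cons_isCycle_iff]
    refine ⟨hpath, fun h => hne ?_⟩
    rw [Sym2.eq_swap] at h
    exact (hedge _ ha₁ _ hb₁ h).symm
  · intro a ha b hb h
    rw [Walk.edges_cons, List.mem_cons] at h
    rcases h with h | h
    · rw [Sym2.eq_iff] at h
      rcases h with ⟨rfl, rfl⟩ | ⟨rfl, rfl⟩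
      · exact absurd hb₁ (hdis _ ha)
      · exact .inl rfl
    · exact .inr (hedge a ha b hb h)

/-- In a cactus there are at most two edges between two disjoint connected sets. -/
theorem IsCactus.edge_between_unique (hG : IsCactus G) (hA : ConnectedOn G A)
    (hB : ConnectedOn G B) (hAB : Disjoint A B) {a₁ a₂ a₃ b₁ b₂ b₃ : V}
    (ha₁ : a₁ ∈ A) (ha₂ : a₂ ∈ A) (ha₃ : a₃ ∈ A) (hb₁ : b₁ ∈ B) (hb₂ : b₂ ∈ B) (hb₃ : b₃ ∈ B)
    (h₁ : G.Adj a₁ b₁) (h₂ : G.Adj a₂ b₂) (h₃ : G.Adj a₃ b₃)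
    (h₂₁ : (a₂, b₂) ≠ (a₁, b₁)) (h₃₁ : (a₃, b₃) ≠ (a₁, b₁)) : (a₃, b₃) = (a₂, b₂) := by
  by_contra h₃₂
  -- Both cycles pass through the edge `a₁b₁`, but only `c` uses `a₂b₂`.
  obtain ⟨c, hc, hac, hec, -⟩ :=
    exists_isCycle_of_two_edges hA hB hAB ha₁ ha₂ hb₁ hb₂ h₁ h₂ h₂₁
  obtain ⟨d, hd, had, -, hed⟩ :=
    exists_isCycle_of_two_edges hA hB hAB ha₁ ha₃ hb₁ hb₃ h₁ h₃ h₃₁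
  refine h₁.ne (hG.2 _ _ c d hc hd ?_ a₁ b₁ hac had c.start_mem_support d.start_mem_support)
  intro h
  have : s(a₂, b₂) ∈ d.toSubgraph.edgeSet := by
    rw [← h, Walk.mem_edges_toSubgraph]
    exact hec
  rw [Walk.mem_edges_toSubgraph] at this
  rcases hed _ ha₂ _ hb₂ this with h | h
  · exact h₂₁ h
  · exact h₃₂ h.symm

end Cactus

/-! ### Small separators. -/

section Separator

variable {V : Type u} [Finite V] {G : SimpleGraph V}

/-- A connected set with at least `m` vertices contains a connected set `D` with at least `m`
vertices, connected complement, and a vertex `v` at which all edges leaving `D` but possibly one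
start, such that all connected subsets of `D \ {v}` have fewer than `m` vertices. -/
theorem exists_minimal_part {m : ℕ} (hm : 0 < m) {U : Set V} (hU : ConnectedOn G U)
    (hUm : m ≤ U.ncard) :
    ∃ D ⊆ U, ConnectedOn G D ∧ ConnectedOn G (U \ D) ∧ m ≤ D.ncard ∧
      ∃ v ∈ D, ((U \ D).Nonempty → ∃ u ∈ U \ D, G.Adj v u) ∧
        ∀ K ⊆ D \ {v}, ConnectedOn G K → K.ncard < m := by
  let P : Set V → Prop := fun D => D ⊆ U ∧ ConnectedOn G D ∧ ConnectedOn G (U \ D) ∧ m ≤ D.ncard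
  have hex : ∃ D, P D := ⟨U, subset_rfl, hU, by simp [ConnectedOn], hUm⟩
  obtain ⟨D, ⟨hDU, hD, hD', hDm⟩, hmin⟩ :=
    exists_minimalFor_of_wellFoundedLT P Set.ncard hex
  have hv : ∃ v ∈ D, ((U \ D).Nonempty → ∃ u ∈ U \ D, G.Adj v u) := by
    obtain ⟨x, hx⟩ : D.Nonempty := (Set.ncard_pos).1 (hm.trans_le hDm)
    by_cases hne : (U \ D).Nonempty
    · obtain ⟨y, hy⟩ := hne
      obtain ⟨v, hv, u, hu, -, huU, huv⟩ := (hU x (hDU hx) y hy.1).exists_boundary hx hy.2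
      exact ⟨v, hv, fun _ => ⟨u, ⟨huU, hu⟩, huv⟩⟩
    · exact ⟨x, hx, fun h => absurd h hne⟩
  obtain ⟨v, hvD, hvu⟩ := hv
  refine ⟨D, hDU, hD, hD', hDm, v, hvD, hvu, fun K hKD hK => ?_⟩
  obtain rfl | ⟨x, hx⟩ := K.eq_empty_or_nonempty
  · simpa using hm
  let L : Set V := {y | ReachIn G (D \ {v}) x y}
  have hKL : K ⊆ L := fun y hy => (hK x hx y hy).mono hKD
  have hLD : L ⊆ D \ {v} := fun y hy => ReachIn.right_mem hy
  refine (Set.ncard_le_ncard hKL).trans_lt ?_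
  by_contra! hLm
  have hvL : v ∉ L := fun h => (hLD h).2 rfl
  -- The complement of `L` hangs together at `v`: the rest of `D` reaches `v`, and `U \ D` is
  -- attached to `v` by an edge. So a large `L` would contradict minimality of `D`.
  have hreach : ∀ z ∈ U \ L, ReachIn G (U \ L) z v := by
    have hDL : ∀ z ∈ D, z ∉ L → ReachIn G (U \ L) z v := fun z hz hzL =>
      (reachIn_diff_component (hD z hz v hvD) hzL).mono (Set.sdiff_subset_sdiff_left hDU)
    rintro z ⟨hzU, hzL⟩
    by_cases hzD : z ∈ D
    · exact hDL z hzD hzL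
    · obtain ⟨u, hu, hadj⟩ := hvu ⟨z, hzU, hzD⟩
      have hsub : U \ D ⊆ U \ L := Set.sdiff_subset_sdiff_right (hLD.trans Set.sdiff_subset)
      exact ((hD' z ⟨hzU, hzD⟩ u hu).mono hsub).trans
        (.of_adj (hsub hu) ⟨hDU hvD, hvL⟩ hadj.symm)
  have hPL : P L := ⟨(hLD.trans Set.sdiff_subset).trans hDU, connectedOn_component _ _ _,
    fun y hy z hz => (hreach y hy).trans (hreach z hz).symm, hLm⟩
  have hlt : L.ncard < D.ncard := Set.ncard_lt_ncard
    (Set.ssubset_iff_subset_ne.2 ⟨hLD.trans Set.sdiff_subset, fun h => hvL (h ▸ hvD)⟩)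
  exact absurd (hmin hPL hlt.le) hlt.not_ge

/-- A cactus on `n` vertices has a set of at most `2 * n / m` vertices whose removal leaves only
components with fewer than `m` vertices. -/
theorem IsCactus.exists_separator (hG : IsCactus G) {m : ℕ} (hm : 0 < m) (N : ℕ) (U : Set V)
    (hU : ConnectedOn G U) (hN : U.ncard = N) :
    ∃ S : Set V, S.ncard * m ≤ 2 * N ∧
      ∀ K ⊆ U \ S, ConnectedOn G K → K.ncard < m := by
  induction N using Nat.strong_induction_on generalizing U with
  | _ N ih =>
  by_cases hUm : U.ncard < m
  · exact ⟨∅, by simp, fun K hK _ =>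
      (Set.ncard_le_ncard (hK.trans Set.sdiff_subset)).trans_lt hUm⟩
  obtain ⟨D, hDU, hD, hD', hDm, v, hvD, hvu, hsmall⟩ := exists_minimal_part hm hU (not_lt.1 hUm)
  have hcard : (U \ D).ncard + D.ncard = N := by
    rw [← hN]
    exact Set.ncard_sdiff_add_ncard_of_subset hDU
  obtain ⟨S, hS, hSK⟩ := ih (U \ D).ncard (by omega) (U \ D) hD' rfl
  -- At most two edges leave `D`, one of them at `v`; `w` is the end in `D` of the other, or `v`
  -- again.
  have hw : ∃ w, ∀ a ∈ D, ∀ b ∈ U \ D, G.Adj a b → a = v ∨ a = w := by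
    by_cases h : ∃ a ∈ D, ∃ b ∈ U \ D, G.Adj a b ∧ a ≠ v
    · obtain ⟨w, hwD, b, hb, hwb, hwv⟩ := h
      refine ⟨w, fun a' ha' b' hb' hadj => ?_⟩
      obtain ⟨u, hu, hvu⟩ := hvu ⟨b, hb⟩
      by_contra! hne
      have := hG.edge_between_unique hD hD' Set.disjoint_sdiff_right hvD hwD ha' hu hb hb'
        hvu hwb hadj (by simp [hwv]) (by simp [hne.1])
      exact hne.2 (Prod.ext_iff.1 this).1
    · push Not at h
      exact ⟨v, fun a ha b hb hadj => .inl (h a ha b hb hadj)⟩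
  obtain ⟨w, hw⟩ := hw
  refine ⟨insert v (insert w S), ?_, fun K hK hKc => ?_⟩
  -- The two new vertices cost `2 * m`, paid for by the at least `m` vertices of `D`.
  · have h1 := Set.ncard_insert_le v (insert w S)
    have h2 := Set.ncard_insert_le w S
    nlinarith
  · have hKv : v ∉ K := fun h => (hK h).2 (by simp)
    have hKw : w ∉ K := fun h => (hK h).2 (by simp)
    have hKS : ∀ x ∈ K, x ∉ S := fun x hx h => (hK hx).2 (by simp [h])
    by_cases hKD : K ⊆ D
    · exact hsmall K (fun x hx => ⟨hKD hx, fun h => hKv (h ▸ hx)⟩) hKc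
    · obtain ⟨y, hyK, hyD⟩ := Set.not_subset.1 hKD
      refine hSK K (fun x hx => ⟨⟨(hK hx).1, fun hxD => ?_⟩, hKS x hx⟩) hKc
      obtain ⟨a, haD, b, hbD, haK, hbK, hab⟩ := (hKc x hx y hyK).exists_boundary hxD hyD
      rcases hw a haD b ⟨(hK hbK).1, hbD⟩ hab with rfl | rfl
      · exact hKv haK
      · exact hKw haK

end Separator

/-! ### The cops' strategy. -/

section Strategy

variable {V : Type u} {G : SimpleGraph V}

theorem Captured.copsCanCapture {k : ℕ} {c : Fin k → V} {r : V} (h : Captured c r) (t : ℕ) :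
    CopsCanCapture G t c r := by
  cases t with
  | zero => exact h
  | succ t => exact .inl h

variable [Finite V]

/-- Static cops hold the vertices of `S`; two mobile cops `i`, `j` at `p`, `q`, joined by a walk
avoiding the robber's territory `R`, capture a robber confined to `R`. -/
theorem IsCactus.copsCanCapture (hG : IsCactus G) {k : ℕ} (S : Set V) (i j : Fin k) (hij : i ≠ j)
    (t : ℕ) (c : Fin k → V) (hS : ∀ s ∈ S, ∃ l, l ≠ i ∧ l ≠ j ∧ c l = s) (R : Set V)
    (hR : ConnectedOn G R) (p q : V) (hp : c i = p) (hq : c j = q) (w : G.Walk q p)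
    (hw : ∀ z ∈ w.support, z ∉ R)
    (hb : ∀ x ∈ R, ∀ y ∉ R, G.Adj x y → y ∈ S ∨ y = p ∨ y = q)
    (hadj : ∃ x ∈ R, G.Adj x p) (r : V) (hr : r ∈ R) (ht : 2 * R.ncard + w.length ≤ t) :
    CopsCanCapture G t c r := by
  induction t generalizing c R p q r with
  | zero =>
    have := (Set.ncard_pos).2 ⟨r, hr⟩
    omega
  | succ t ih =>
  have hpR : p ∉ R := hw p w.end_mem_support
  -- Cop `i` may step into `R` at `a` once no other vertex of `R` needs `p` guarded. The territory
  -- loses `a` and the walk gains one edge, so `2 * R.ncard + w.length` drops.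
  have advance : ∀ a ∈ R, G.Adj a p →
      (∀ x ∈ R, x ≠ a → ∀ y ∉ R, G.Adj x y → y ∈ S ∨ y = q) →
      CopsCanCapture G (t + 1) c r := by
    intro a haR hap hba
    have hS' : ∀ s ∈ S, ∃ l, l ≠ i ∧ l ≠ j ∧ Function.update c i a l = s := by
      intro s hs
      obtain ⟨l, hli, hlj, hl⟩ := hS s hs
      exact ⟨l, hli, hlj, by rw [Function.update_of_ne hli, hl]⟩
    have hi' : Function.update c i a i = a := Function.update_self ..
    have hj' : Function.update c i a j = q := by rw [Function.update_of_ne hij.symm, hq]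
    refine .inr ⟨Function.update c i a, fun l => ?_, ?_⟩
    · by_cases hl : l = i
      · subst hl
        rw [hi', hp]
        exact .inr hap.symm
      · rw [Function.update_of_ne hl]
        exact .inl rfl
    by_cases hra : r = a
    · exact .inl ⟨i, hi'.trans hra.symm⟩
    refine .inr fun r' hr' => ?_
    let L : Set V := {y | ReachIn G (R \ {a}) r y}
    have hLR : L ⊆ R \ {a} := fun y hy => ReachIn.right_mem hy
    have hrL : r ∈ L := ReachIn.refl ⟨hr, hra⟩
    have haL : a ∉ L := fun h => (hLR h).2 rfl
    have hbL : ∀ x ∈ L, ∀ y ∉ L, G.Adj x y → y ∈ S ∨ y = a ∨ y = q := by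
      intro x hx y hy hxy
      by_cases hya : y = a
      · exact .inr (.inl hya)
      by_cases hyR : y ∈ R
      · exact absurd (ReachIn.trans hx (.of_adj (hLR hx) ⟨hyR, hya⟩ hxy)) hy
      · exact (hba x (hLR hx).1 (hLR hx).2 y hyR hxy).imp_right .inr
    by_cases hr'L : r' ∈ L
    · refine ih (Function.update c i a) hS' L (connectedOn_component _ _ _) a q hi' hj'
        (w.concat hap.symm) ?_ hbL ?_ r' hr'L ?_
      · intro z hz
        rw [Walk.support_concat, List.mem_append, List.mem_singleton] at hz
        rcases hz with hz | rfl
        · exact fun h => hw z hz (hLR h).1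
        · exact haL
      · obtain ⟨x, hx, y, hy, -, hyR, hxy⟩ := (hR r hr a haR).exists_boundary hrL haL
        by_cases hya : y = a
        · exact ⟨x, hx, hya ▸ hxy⟩
        · exact absurd (ReachIn.trans hx (.of_adj (hLR hx) ⟨hyR, hya⟩ hxy)) hy
      · have : L.ncard < R.ncard := Set.ncard_lt_ncard
          (Set.ssubset_iff_subset_ne.2 ⟨hLR.trans Set.sdiff_subset, fun h => haL (h ▸ haR)⟩)
        rw [Walk.length_concat]
        omega
    · refine Captured.copsCanCapture ?_ t
      rcases hr' with rfl | hr'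
      · exact absurd hrL hr'L
      rcases hbL r hrL r' hr'L hr' with h | rfl | rfl
      · obtain ⟨l, -, -, hl⟩ := hS' r' h
        exact ⟨l, hl⟩
      · exact ⟨i, hi'⟩
      · exact ⟨j, hj'⟩
  obtain ⟨a, haR, hap⟩ := hadj
  by_cases hqR : ∃ x ∈ R, G.Adj x q
  · by_cases hpq : p = q
    · exact advance a haR hap fun x hx _ y hy hxy => (hb x hx y hy hxy).imp_right
        (Or.elim · (·.trans hpq) id)
    -- The edges `ap` and `bq` already are the two allowed between `R` and the walk, so `a` is the
    -- only neighbor of `p` in `R`.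
    · obtain ⟨b, hbR, hbq⟩ := hqR
      refine advance a haR hap fun x hx hxa y hy hxy => ?_
      rcases hb x hx y hy hxy with h | rfl | h
      · exact .inl h
      · have := hG.edge_between_unique hR (connectedOn_support w)
          (Set.disjoint_left.2 fun z hz hz' => hw z hz' hz) haR hbR hx w.end_mem_support
          w.start_mem_support w.end_mem_support hap hbq hxy
          (fun h => hpq (Prod.ext_iff.1 h).2.symm) (fun h => hxa (Prod.ext_iff.1 h).1)
        exact absurd (Prod.ext_iff.1 this).2 hpq
      · exact .inr h
  -- Cop `j` guards nothing at `q`, so it walks towards `p`, shortening the walk while `R` stays.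
  · push Not at hqR
    cases w with
    | nil => exact absurd hap (hqR a haR)
    | @cons _ q' _ hqq' w =>
    have hS' : ∀ s ∈ S, ∃ l, l ≠ i ∧ l ≠ j ∧ Function.update c j q' l = s := by
      intro s hs
      obtain ⟨l, hli, hlj, hl⟩ := hS s hs
      exact ⟨l, hli, hlj, by rw [Function.update_of_ne hlj, hl]⟩
    have hj' : Function.update c j q' j = q' := Function.update_self ..
    have hi' : Function.update c j q' i = p := by rw [Function.update_of_ne hij, hp]
    have hb' : ∀ x ∈ R, ∀ y ∉ R, G.Adj x y → y ∈ S ∨ y = p ∨ y = q' := by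
      intro x hx y hy hxy
      rcases hb x hx y hy hxy with h | h | rfl
      · exact .inl h
      · exact .inr (.inl h)
      · exact absurd hxy (hqR x hx)
    refine .inr ⟨Function.update c j q', fun l => ?_, .inr fun r' hr' => ?_⟩
    · by_cases hl : l = j
      · subst hl
        rw [hj', hq]
        exact .inr hqq'
      · rw [Function.update_of_ne hl]
        exact .inl rfl
    by_cases hr'R : r' ∈ R
    · refine ih _ hS' R hR p q' hi' hj' w (fun z hz => hw z (by simp [hz])) hb' ⟨a, haR, hap⟩
        r' hr'R ?_
      rw [Walk.length_cons] at ht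
      omega
    · refine Captured.copsCanCapture ?_ t
      rcases hr' with rfl | hr'
      · exact absurd hr hr'R
      rcases hb' r hr r' hr'R hr' with h | rfl | rfl
      · obtain ⟨l, -, -, hl⟩ := hS' r' h
        exact ⟨l, hl⟩
      · exact ⟨i, hi'⟩
      · exact ⟨j, hj'⟩

/-- Three cops on each vertex of a nonempty separator leaving components with fewer than `m`
vertices win within `2 * m` rounds. -/
theorem IsCactus.copsWinWithin (hG : IsCactus G) {m : ℕ} {S : Set V} (hS : S.Nonempty)
    (hSm : ∀ K ⊆ Sᶜ, ConnectedOn G K → K.ncard < m) :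
    CopsWinWithin G (S.ncard * 3) (2 * (m - 1)) := by
  have hcard : Nat.card (S × Fin 3) = S.ncard * 3 := by
    rw [Nat.card_prod, Nat.card_coe_set_eq, Nat.card_eq_fintype_card, Fintype.card_fin]
  -- Copy `0` at each vertex stays put; copies `1` and `2` at one vertex `s` bordering `R` become
  -- the mobile pair.
  let e : S × Fin 3 ≃ Fin (S.ncard * 3) := Finite.equivFinOfCardEq hcard
  have he : ∀ x, ((e.symm (e x)).1 : V) = x.1 := fun x => by rw [e.symm_apply_apply]
  refine ⟨fun l => (e.symm l).1, fun r => ?_⟩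
  by_cases hr : r ∈ S
  · exact Captured.copsCanCapture ⟨e (⟨r, hr⟩, 0), he _⟩ _
  let R : Set V := {y | ReachIn G Sᶜ r y}
  have hRS : R ⊆ Sᶜ := fun y hy => ReachIn.right_mem hy
  have hrR : r ∈ R := ReachIn.refl hr
  have hb : ∀ x ∈ R, ∀ y ∉ R, G.Adj x y → y ∈ S := by
    intro x hx y hy hxy
    by_contra hyS
    exact hy (ReachIn.trans hx (.of_adj (hRS hx) hyS hxy))
  obtain ⟨s₀, hs₀⟩ := hS
  obtain ⟨x, hx, s, hsR, -, -, hxs⟩ :=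
    (connectedOn_univ hG.1 r trivial s₀ trivial).exists_boundary hrR (fun h => hRS h hs₀)
  have hs := hb x hx s hsR hxs
  refine hG.copsCanCapture S (e (⟨s, hs⟩, 1)) (e (⟨s, hs⟩, 2)) (by simp) _ _ ?_ R
    (connectedOn_component _ _ _) s s (he _) (he _) .nil (by simpa using hsR)
    (fun x hx y hy hxy => .inl (hb x hx y hy hxy)) ⟨x, hx, hxs⟩ r hrR ?_
  · intro s' hs'
    exact ⟨e (⟨s', hs'⟩, 0), by simp, by simp, he _⟩
  · have := hSm R hRS (connectedOn_component _ _ _)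
    rw [Walk.length_nil]
    omega

end Strategy

/-! ### The numerical bound. -/

theorem throttlingNumber_le {V : Type u} {G : SimpleGraph V} {k t : ℕ} (hk : 1 ≤ k)
    (h : CopsWinWithin G k t) : throttlingNumber G ≤ ((k + t : ℕ) : ℕ∞) := by
  rw [Nat.cast_add]
  exact (iInf₂_le k hk).trans (add_le_add le_rfl (iInf₂_le t h))

theorem IsCactus.throttlingNumber_bound {V : Type u} [Fintype V] {G : SimpleGraph V}
    (hG : IsCactus G) :
    ∃ t : ℕ, throttlingNumber G = (t : ℕ∞) ∧
      (t : ℝ) ≤ 8 * Real.sqrt (Fintype.card V) + 3 := by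
  set n := Fintype.card V with hn
  let m := n.sqrt + 1
  obtain ⟨S, hSn, hS⟩ := hG.exists_separator (Nat.succ_pos n.sqrt) n Set.univ
    (connectedOn_univ hG.1) (by rw [Set.ncard_univ, Nat.card_eq_fintype_card])
  obtain ⟨v⟩ := hG.1.nonempty
  -- The separator may be empty; adding `v` guarantees at least one cop.
  have hwin := hG.copsWinWithin (S := insert v S) (m := m) (Set.insert_nonempty _ _)
    fun K hK hKc => hS K (fun x hx => ⟨trivial, fun h => hK hx (Set.mem_insert_of_mem v h)⟩) hKc
  have hpos : 0 < (insert v S).ncard := (Set.ncard_pos).2 (Set.insert_nonempty _ _)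
  have hle := throttlingNumber_le (by omega) hwin
  obtain ⟨t, ht⟩ := ENat.ne_top_iff_exists.1 (ne_top_of_le_ne_top (ENat.natCast_ne_top _) hle)
  refine ⟨t, ht.symm, ?_⟩
  rw [← ht, Nat.cast_le] at hle
  have hins := Set.ncard_insert_le v S
  have htS : t ≤ (S.ncard + 1) * 3 + 2 * n.sqrt := by
    simp only [m, Nat.add_sub_cancel] at hle
    omega
  have hs0 := Real.sqrt_nonneg (n : ℝ)
  have hss := Real.sq_sqrt (Nat.cast_nonneg (α := ℝ) n)
  have h1 : (n.sqrt : ℝ) ≤ √n := Real.nat_sqrt_le_real_sqrt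
  have h2 : √(n : ℝ) ≤ n.sqrt + 1 := Real.real_sqrt_le_nat_sqrt_succ
  have h3 : (S.ncard : ℝ) * (n.sqrt + 1) ≤ 2 * n := by exact_mod_cast hSn
  have hn0 : (0 : ℝ) < n := by exact_mod_cast Fintype.card_pos_iff.2 ⟨v⟩
  -- Hence at most `6√n + 3` cops, plus at most `2√n` rounds.
  have h4 : (S.ncard : ℝ) ≤ 2 * √n := by
    have hsp : 0 < √(n : ℝ) := Real.sqrt_pos.2 hn0
    refine le_of_mul_le_mul_right ?_ hsp
    have := mul_le_mul_of_nonneg_left h2 (Nat.cast_nonneg (α := ℝ) S.ncard)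
    linarith
  have h5 : (t : ℝ) ≤ (S.ncard + 1) * 3 + 2 * n.sqrt := by exact_mod_cast htS
  linarith

theorem mainTheorem5 :
    (∃ C : ℝ, ∀ (V : Type u) [Fintype V] (G : SimpleGraph V), IsCactus G →
      ∃ t : ℕ, throttlingNumber G = (t : ℕ∞) ∧ (t : ℝ) ≤ C * Real.sqrt (Fintype.card V)) ∧
    (∀ (V : Type u) [Fintype V] (G : SimpleGraph V), IsCactus G →
      ∃ t : ℕ, throttlingNumber G = (t : ℕ∞) ∧
        (t : ℝ) ≤ 16 * Real.sqrt (Fintype.card V) + 16) := by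
  -- `11 = 8 + 3`, the additive `3` being absorbed since `√n ≥ 1`.
  refine ⟨⟨11, fun V _ G hG => ?_⟩, fun V _ G hG => ?_⟩
  · obtain ⟨t, ht, hle⟩ := hG.throttlingNumber_bound
    obtain ⟨v⟩ := hG.1.nonempty
    have h1 : (1 : ℝ) ≤ √(Fintype.card V) := by
      rw [Real.one_le_sqrt]
      exact_mod_cast Fintype.card_pos_iff.2 ⟨v⟩
    exact ⟨t, ht, by linarith⟩
  · obtain ⟨t, ht, hle⟩ := hG.throttlingNumber_bound
    exact ⟨t, ht, by linarith [Real.sqrt_nonneg (Fintype.card V : ℝ)]⟩
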